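/- For $|q|<1$, the $q$-semicircular law is the probability law on $\mathbb{R}$ with density \[ w(x)=\frac1\pi\sqrt{1-q}\,\sin\theta\prod_{m\ge1}(1-q^m)\,|1-q^me^{2i\theta}|^2 \] if $-2\le x\sqrt{1-q}\le 2$, where $\theta\in[0,\pi]$ is such that $2\cos\theta=x\sqrt{1-q}$, and $w(x)=0$ otherwise. (At $q=0$ it is the semicircular law, with density $\frac1{2\pi}\sqrt{4-x^2}$ on $[-2,2]$.) Let $m_j(q)$ be its moments, let its cumulants $k_j(q)$ be defined by the identity of formal power series \[ \sum_{j\ge1}k_j(q)\frac{z^j}{j!}=\log\Bigl(\sum_{j\ge0}m_j(q)\frac{z^j}{j!}\Bigr), \] and for $n\ge1$ let $\tilde k_{2n}(q)=k_{2n}(q)/(q-1)^{n-1}$, so that $\tilde k_{2n}(0)=(-1)^{n-1}k_{2n}(0)$. A matching $\sigma$ of $\{1,\dots,2n\}$ is a set partition all of whose blocks (called arches) have size $2$; it is connected if no proper interval of $\{1,\dots,2n\}$ (that is, no nonempty interval other than $\{1,\dots,2n\}$ itself) is a union of arches of $\sigma$. The crossing graph $G(\sigma)$ has the arches of $\sigma$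 as its vertices, and two arches are adjacent if and only if they can be written $\{i,j\}$ and $\{k,\ell\}$ with $i<k<j<\ell$. A source of an orientation is a vertex with no ingoing arrows. **Theorem.** For every $n\ge1$, the number $\tilde k_{2n}(0)$ is equal to the number of pairs $(\sigma,r)$ where $\sigma$ is a connected matching of $\{1,\dots,2n\}$ and $r$ is an acyclic orientation of $G(\sigma)$ whose unique source is the arch of $\sigma$ containing $1$. -/

import Mathlib

/-! ### The `q`-semicircular law and its cumulants -/

noncomputable section

/-- The density of the `q`-semicircular law (for `|q| < 1`). With `θ ∈ [0, π]` such that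
`2 cos θ = x √(1 - q)`, it is
`(1 / π) √(1 - q) sin θ ∏_{n ≥ 1} (1 - q ^ n) |1 - q ^ n e ^ {2 i θ}| ^ 2`
if `-2 ≤ x √(1 - q) ≤ 2`, and `0` otherwise. -/
def qSemicircularDensity (q x : ℝ) : ℝ :=
  open Classical in
  if -2 ≤ x * √(1 - q) ∧ x * √(1 - q) ≤ 2 then
    let θ : ℝ := Real.arccos (x * √(1 - q) / 2)
    1 / Real.pi * √(1 - q) * Real.sin θ *
      ∏' n : ℕ, ((1 - q ^ (n + 1)) *
        ‖(1 : ℂ) - (q : ℂ) ^ (n + 1) * Complex.exp (2 * Complex.I * (θ : ℂ))‖ ^ 2)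
  else 0

/-- The `q`-semicircular law (for `|q| < 1`). -/
def qSemicircularLaw (q : ℝ) : MeasureTheory.Measure ℝ :=
  MeasureTheory.volume.withDensity fun x => ENNReal.ofReal (qSemicircularDensity q x)

/-- The `n`-th moment `m_n(q)` of the `q`-semicircular law. -/
def qMoment (q : ℝ) (n : ℕ) : ℝ :=
  ProbabilityTheory.moment id n (qSemicircularLaw q)

/-- The `n`-th cumulant `k_n(q)` of the `q`-semicircular law, defined by the identity
`∑_{n ≥ 1} k_n(q) z ^ n / n! = log (∑_{n ≥ 0} m_n(q) z ^ n / n!)` of formal power series. -/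
def qCumulant (q : ℝ) (n : ℕ) : ℝ :=
  (n.factorial : ℝ) *
    PowerSeries.coeff n
      (PowerSeries.logOf (PowerSeries.mk fun m => qMoment q m / (m.factorial : ℝ)))

/-- `k̃_{2n}(q) = k_{2n}(q) / (q - 1) ^ (n - 1)`, for `n ≥ 1`. -/
def normalizedCumulant (q : ℝ) (n : ℕ) : ℝ :=
  qCumulant q (2 * n) / (q - 1) ^ (n - 1)

end

/-! ### Matchings and crossing graphs -/

/-- A set partition `π` of `{1, …, m}` is connected if no proper interval of `{1, …, m}` is a union
of blocks of `π`. -/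
def IsConnectedPartition {m : ℕ} (π : Finpartition (Finset.Icc 1 m)) : Prop :=
  ∀ a b : ℕ, 1 ≤ a → a ≤ b → b ≤ m →
    (∃ S ⊆ π.parts, S.biUnion id = Finset.Icc a b) → Finset.Icc a b = Finset.Icc 1 m

/-- The connected matchings of `{1, …, 2n}`: the connected set partitions of `{1, …, 2n}` all of
whose blocks (called arches) have size `2`. -/
def ConnectedMatching (n : ℕ) : Type :=
  {σ : Finpartition (Finset.Icc 1 (2 * n)) //
    (∀ b ∈ σ.parts, b.card = 2) ∧ IsConnectedPartition σ}

/-- The arches `x = {i, j}` and `y = {k, l}` satisfy `i < k < j < l`. -/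
def CrossesLeft (x y : Finset ℕ) : Prop :=
  ∃ i j k l : ℕ, x = {i, j} ∧ y = {k, l} ∧ i < k ∧ k < j ∧ j < l

/-- The crossing graph `G(σ)`: the vertices are the blocks of `σ`, and two blocks are adjacent if
and only if they cross. -/
def crossingGraph {m : ℕ} (σ : Finpartition (Finset.Icc 1 m)) : SimpleGraph σ.parts where
  Adj x y := CrossesLeft x y ∨ CrossesLeft y x
  symm := ⟨fun _ _ h => h.symm⟩
  loopless := ⟨by
    have key : ∀ x : Finset ℕ, ¬ CrossesLeft x x := by
      rintro x ⟨i, j, k, l, h1, h2, hik, hkj, hjl⟩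
      have hi : i ∈ ({k, l} : Finset ℕ) := by rw [← h2, h1]; simp
      simp only [Finset.mem_insert, Finset.mem_singleton] at hi
      omega
    rintro x (h | h) <;> exact key _ h⟩

/-! ### Acyclic orientations -/

/-- An acyclic orientation of a simple graph: each edge `{u, v}` receives exactly one of the two
directions `u → v` and `v → u`, and there is no directed cycle. -/
structure AcyclicOrientation {V : Type*} (G : SimpleGraph V) where
  /-- `arrow u v` means that there is an arrow from `u` to `v`. -/
  arrow : V → V → Prop
  adj_iff : ∀ u v, G.Adj u v ↔ arrow u v ∨ arrow v u
  asymm : ∀ u v, arrow u v → ¬ arrow v u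
  acyclic : ∀ v, ¬ Relation.TransGen arrow v v

/-- A source is a vertex having no ingoing arrows. -/
def AcyclicOrientation.IsSource {V : Type*} {G : SimpleGraph V} (r : AcyclicOrientation G)
    (v : V) : Prop :=
  ∀ u, ¬ r.arrow u v

/-!
Only `q = 0` is involved, where the moments of the law are the aerated Catalan numbers (substitute
`x = 2 cos t`), that is, the numbers of noncrossing matchings. Differentiating the logarithm turns
the definition of the cumulants `k_j` into the recursion
`m_{N+1} = ∑ i ≤ N, (N choose i) * k_{i+1} * m_{N-i}`, which determines them. The theorem says that
`k_{|A|}` is the signed count `signedRootedCount A a` of pairs of a matching of `A` and an acyclic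
orientation of its crossing graph whose unique source is the arch containing `a`, with sign
`(-1) ^ (number of arches - 1)`.

It is therefore enough that, for `a ∈ A`, the sum over the subsets `B` of `A` containing `a` of the
signed count for `B` times the number of noncrossing matchings of `A \ B` is the number of
noncrossing matchings of `A` (`sum_signedRootedCount_mul`). A matching of `B` and a noncrossing
matching of `A \ B` form a matching of `A` with a distinguished set `S` of arches whose complement is
independent in the crossing graph. So the identity can be proved one matching of `A` at a time, and
it becomes a statement on an arbitrary finite graph with a chosen vertex `v`
(`sum_card_rootedOrientations`): the alternating sum, over the sets `S ∋ v` with independent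
complement, of the number of acyclic orientations of `S` with unique source `v` is `1` if the graph
has no edge and `0` otherwise. This follows from a sign-reversing involution: a vertex outside `S`
having a neighbour in `S` can be inserted in `S` as a sink, and a sink of `S` other than `v` having
no neighbour outside `S` can be removed from `S`. A move does not change which vertices can be moved,
and at least one exists if there is an edge.

Since the identity holds for every `a ∈ A`, induction on `|A|` gives `signedRootedCount A a =
k_{|A|}` directly, without relabelling matchings. Finally, a matching whose crossing graph has an
acyclic orientation with a unique source is connected (`eq_of_biUnion_eq_Icc`), so that the
connectedness condition in the theorem is automatic.
-/

namespace SemicircularCumulants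

/-! ### Moments and cumulants of the semicircular law -/

open MeasureTheory

/-- The Catalan numbers spread over the even integers: `C_{k/2}` if `k` is even, `0` otherwise. -/
def aeratedCatalan (k : ℕ) : ℕ := if Even k then catalan (k / 2) else 0

lemma aeratedCatalan_zero : aeratedCatalan 0 = 1 := by simp [aeratedCatalan]

lemma aeratedCatalan_one : aeratedCatalan 1 = 0 := by simp [aeratedCatalan]

lemma aeratedCatalan_two_mul (n : ℕ) : aeratedCatalan (2 * n) = catalan n := by
  simp [aeratedCatalan]

lemma aeratedCatalan_two_mul_add_one (n : ℕ) : aeratedCatalan (2 * n + 1) = 0 := by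
  simp [aeratedCatalan]

lemma sum_range_two_mul_add_one {f : ℕ → ℕ} (hf : ∀ j, f (2 * j + 1) = 0) (n : ℕ) :
    ∑ i ∈ Finset.range (2 * n + 1), f i = ∑ j ∈ Finset.range (n + 1), f (2 * j) := by
  induction n with
  | zero => simp
  | succ n ih =>
    rw [show 2 * (n + 1) + 1 = 2 * n + 1 + 1 + 1 by ring, Finset.sum_range_succ,
      Finset.sum_range_succ, ih, hf, Finset.sum_range_succ _ (n + 1)]
    rfl

lemma sum_range_aeratedCatalan_mul (k : ℕ) :
    ∑ i ∈ Finset.range (k + 1), aeratedCatalan i * aeratedCatalan (k - i) =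
      aeratedCatalan (k + 2) := by
  rcases Nat.even_or_odd' k with ⟨n, rfl | rfl⟩
  · rw [show 2 * n + 2 = 2 * (n + 1) by ring, aeratedCatalan_two_mul, catalan_succ,
      Fin.sum_univ_eq_sum_range (fun i => catalan i * catalan (n - i)),
      sum_range_two_mul_add_one fun j => by rw [aeratedCatalan_two_mul_add_one, zero_mul]]
    exact Finset.sum_congr rfl fun j _ => by
      rw [← Nat.mul_sub, aeratedCatalan_two_mul, aeratedCatalan_two_mul]
  · rw [show 2 * n + 1 + 2 = 2 * (n + 1) + 1 by ring, aeratedCatalan_two_mul_add_one]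
    refine Finset.sum_eq_zero fun i hi => ?_
    rw [Finset.mem_range] at hi
    rcases Nat.even_or_odd' i with ⟨j, rfl | rfl⟩
    · rw [show 2 * n + 1 - 2 * j = 2 * (n - j) + 1 by omega, aeratedCatalan_two_mul_add_one,
        mul_zero]
    · rw [aeratedCatalan_two_mul_add_one, zero_mul]

lemma qSemicircularDensity_zero (x : ℝ) :
    qSemicircularDensity 0 x =
      (Set.Icc (-2 : ℝ) 2).indicator (fun y => √(1 - (y / 2) ^ 2) / Real.pi) x := by
  simp [qSemicircularDensity, Set.indicator_apply, Real.sin_arccos]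
  grind

lemma integral_cos_pow_two_mul (n : ℕ) :
    ∫ t in (0 : ℝ)..Real.pi, Real.cos t ^ (2 * n) = Real.pi * n.centralBinom / 4 ^ n := by
  induction n with
  | zero => simp
  | succ n ih =>
    rw [show 2 * (n + 1) = 2 * n + 2 by ring, integral_cos_pow, ih]
    have h : ((n + 1 : ℕ) : ℝ) * (n + 1).centralBinom = 2 * (2 * n + 1) * n.centralBinom := by
      exact_mod_cast Nat.succ_mul_centralBinom_succ n
    push_cast at h
    have h1 : (n + 1 : ℝ) ≠ 0 := by positivity
    rw [eq_div_of_mul_eq h1 ((mul_comm _ _).trans h)]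
    simp
    field_simp
    ring

lemma integral_cos_pow_two_mul_add_one (n : ℕ) :
    ∫ t in (0 : ℝ)..Real.pi, Real.cos t ^ (2 * n + 1) = 0 := by
  induction n with
  | zero => simp
  | succ n ih =>
    rw [show 2 * (n + 1) + 1 = (2 * n + 1) + 2 by ring, integral_cos_pow, ih]
    simp

/-- The substitution `x = 2 cos t` in the moments of the semicircular law. -/
lemma qMoment_zero_eq_integral_cos (k : ℕ) :
    qMoment 0 k = ∫ t in (0 : ℝ)..Real.pi,
      2 ^ (k + 1) / Real.pi * (Real.cos t ^ k - Real.cos t ^ (k + 2)) := by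
  have hd : qSemicircularDensity 0 =
      (Set.Icc (-2 : ℝ) 2).indicator (fun y => √(1 - (y / 2) ^ 2) / Real.pi) :=
    funext qSemicircularDensity_zero
  have hmeas : Measurable (qSemicircularDensity 0) := by
    rw [hd]
    exact Measurable.indicator (by fun_prop) measurableSet_Icc
  have hnn : ∀ x, 0 ≤ qSemicircularDensity 0 x := by
    intro x
    rw [hd]
    exact Set.indicator_nonneg (fun y _ => by positivity) x
  have h1 : qMoment 0 k = ∫ x in (-2 : ℝ)..2, x ^ k * (√(1 - (x / 2) ^ 2) / Real.pi) := by
    rw [qMoment, ProbabilityTheory.moment_def, qSemicircularLaw,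
      integral_withDensity_eq_integral_toReal_smul hmeas.ennreal_ofReal (by simp),
      intervalIntegral.integral_of_le (by norm_num), ← integral_Icc_eq_integral_Ioc,
      ← integral_indicator measurableSet_Icc]
    refine integral_congr_ae (Filter.Eventually.of_forall fun x => ?_)
    change (ENNReal.ofReal (qSemicircularDensity 0 x)).toReal • x ^ k = _
    rw [ENNReal.toReal_ofReal (hnn x), hd]
    simp only [Set.indicator_apply]
    split_ifs <;> simp [mul_comm]
  have h2 := intervalIntegral.integral_comp_mul_deriv (a := 0) (b := Real.pi)
    (f := fun t => 2 * Real.cos t) (f' := fun t => 2 * -Real.sin t)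
    (g := fun x => x ^ k * (√(1 - (x / 2) ^ 2) / Real.pi))
    (fun t _ => (Real.hasDerivAt_cos t).const_mul 2) (by fun_prop) (by fun_prop)
  rw [h1, intervalIntegral.integral_symm]
  simp only [Real.cos_zero, Real.cos_pi, mul_one, mul_neg] at h2
  rw [← h2, ← intervalIntegral.integral_neg]
  refine intervalIntegral.integral_congr fun t ht => ?_
  rw [Set.uIcc_of_le Real.pi_pos.le] at ht
  have hs := Real.sin_nonneg_of_mem_Icc ht
  have : √(1 - (2 * Real.cos t / 2) ^ 2) = Real.sin t := by
    rw [mul_div_cancel_left₀ _ two_ne_zero, ← Real.sin_sq, Real.sqrt_sq hs]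
  simp only [Function.comp, this]
  have hc : Real.cos t ^ (k + 2) = Real.cos t ^ k * (1 - Real.sin t ^ 2) := by
    rw [pow_add, Real.cos_sq']
  rw [hc]
  ring

lemma qMoment_zero (k : ℕ) : qMoment 0 k = aeratedCatalan k := by
  rw [qMoment_zero_eq_integral_cos, intervalIntegral.integral_const_mul,
    intervalIntegral.integral_sub (Continuous.intervalIntegrable (by fun_prop) _ _)
      (Continuous.intervalIntegrable (by fun_prop) _ _)]
  rcases Nat.even_or_odd' k with ⟨n, rfl | rfl⟩
  · rw [show 2 * n + 2 = 2 * (n + 1) by ring, integral_cos_pow_two_mul,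
      integral_cos_pow_two_mul, aeratedCatalan_two_mul]
    have h : ((n + 1 : ℕ) : ℝ) * (n + 1).centralBinom = 2 * (2 * n + 1) * n.centralBinom := by
      exact_mod_cast Nat.succ_mul_centralBinom_succ n
    have h' : ((n + 1 : ℕ) : ℝ) * catalan n = n.centralBinom := by
      exact_mod_cast succ_mul_catalan_eq_centralBinom n
    push_cast at h h'
    have h1 : (n + 1 : ℝ) ≠ 0 := by positivity
    rw [eq_div_of_mul_eq h1 ((mul_comm _ _).trans h), ← h', pow_succ 2, pow_mul]
    have := Real.pi_ne_zero
    norm_num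
    field_simp
    ring
  · rw [show 2 * n + 1 + 2 = 2 * (n + 1) + 1 by ring, integral_cos_pow_two_mul_add_one,
      integral_cos_pow_two_mul_add_one, aeratedCatalan_two_mul_add_one]
    simp

lemma derivative_logOf_mul {f : PowerSeries ℝ} (hf : PowerSeries.constantCoeff f = 1) :
    PowerSeries.derivative ℝ (PowerSeries.logOf f) * f = PowerSeries.derivative ℝ f := by
  have hs : PowerSeries.HasSubst (f - 1) :=
    PowerSeries.HasSubst.of_constantCoeff_zero' (by simp [hf])
  have hg : PowerSeries.derivative ℝ (PowerSeries.log ℝ) * (1 + PowerSeries.X) = 1 := by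
    rw [PowerSeries.deriv_log]
    ext n
    rcases n with - | n
    · simp [mul_add]
    · simp [mul_add, PowerSeries.coeff_one, pow_succ]
  have h := congrArg (PowerSeries.subst (f - 1)) hg
  rw [PowerSeries.subst_mul hs, PowerSeries.subst_add hs, PowerSeries.subst_X hs,
    ← PowerSeries.coe_substAlgHom hs, map_one, add_sub_cancel,
    PowerSeries.coe_substAlgHom hs] at h
  rw [PowerSeries.logOf_eq, PowerSeries.derivative_subst hs, mul_right_comm, h, one_mul, map_sub,
    PowerSeries.derivative_one, sub_zero]

/-- The moment-cumulant recursion. -/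
lemma qMoment_zero_succ (n : ℕ) :
    qMoment 0 (n + 1) = ∑ i ∈ Finset.range (n + 1),
      (n.choose i : ℝ) * qCumulant 0 (i + 1) * qMoment 0 (n - i) := by
  set f : PowerSeries ℝ := PowerSeries.mk fun m => qMoment 0 m / (m.factorial : ℝ) with hf
  have h0 : PowerSeries.constantCoeff f = 1 := by
    rw [hf, ← PowerSeries.coeff_zero_eq_constantCoeff_apply]
    simp [qMoment_zero, aeratedCatalan_zero]
  have h := congrArg (PowerSeries.coeff n) (derivative_logOf_mul h0)
  rw [PowerSeries.coeff_mul, PowerSeries.coeff_derivative,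
    Finset.Nat.sum_antidiagonal_eq_sum_range_succ_mk] at h
  simp only [PowerSeries.coeff_derivative, hf, PowerSeries.coeff_mk] at h
  rw [← hf] at h
  have hn : (n.factorial : ℝ) ≠ 0 := by positivity
  have h3 : qMoment 0 (n + 1) = n.factorial *
      (qMoment 0 (n + 1) / ((n + 1).factorial : ℝ) * (n + 1)) := by
    rw [Nat.factorial_succ]
    push_cast
    field_simp
  rw [h3, ← h, Finset.mul_sum]
  refine Finset.sum_congr rfl fun i hi => ?_
  rw [Finset.mem_range] at hi
  rw [Nat.cast_choose ℝ (by omega : i ≤ n), qCumulant, ← hf, Nat.factorial_succ]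
  push_cast
  field_simp

/-! ### Acyclic orientations with a prescribed unique source -/

/-- A finite nonempty set has a minimal element for an acyclic relation. -/
lemma exists_mem_forall_not_rel {α : Type*} {ρ : α → α → Prop}
    (hac : ∀ u, ¬ Relation.TransGen ρ u u) {T : Finset α} (hT : T.Nonempty) :
    ∃ u ∈ T, ∀ w ∈ T, ¬ ρ w u := by
  have : IsStrictOrder α (Relation.TransGen ρ) :=
    { irrefl := hac, trans := fun _ _ _ => Relation.TransGen.trans }
  have hwf : Set.WellFoundedOn (T : Set α) (Relation.TransGen ρ) :=
    T.finite_toSet.wellFoundedOn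
  obtain ⟨⟨u, hu⟩, -, hmin⟩ := WellFounded.has_min hwf Set.univ
    (hT.to_subtype.elim fun x => ⟨x, trivial⟩)
  exact ⟨u, hu, fun w hw h => hmin ⟨w, hw⟩ trivial (.single h)⟩

open scoped Classical in
/-- The acyclic orientations, with set of sources `{u ∈ S | root u}`, of the graph induced on `S`
by the relation `adj`. An orientation is encoded as its set of arrows. -/
noncomputable def rootedOrientations {α : Type*} [DecidableEq α] (adj : α → α → Prop)
    (root : α → Prop) (S : Finset α) : Finset (Finset (α × α)) :=
  {r ∈ (S ×ˢ S).powerset |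
    (∀ u ∈ S, ∀ w ∈ S, adj u w ↔ (u, w) ∈ r ∨ (w, u) ∈ r) ∧
    (∀ u, ¬ Relation.TransGen (fun x y => (x, y) ∈ r) u u) ∧
    ∀ u ∈ S, (∀ w, (w, u) ∉ r) ↔ root u}

section

variable {α : Type*} [DecidableEq α] {adj : α → α → Prop} {V S : Finset α} {v : α}
  {r : Finset (α × α)}

lemma mem_rootedOrientations {root : α → Prop} :
    r ∈ rootedOrientations adj root S ↔ r ⊆ S ×ˢ S ∧
      (∀ u ∈ S, ∀ w ∈ S, adj u w ↔ (u, w) ∈ r ∨ (w, u) ∈ r) ∧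
      (∀ u, ¬ Relation.TransGen (fun x y => (x, y) ∈ r) u u) ∧
      ∀ u ∈ S, (∀ w, (w, u) ∉ r) ↔ root u := by
  simp [rootedOrientations]

lemma rootedOrientations_congr {root root' : α → Prop} (h : ∀ u ∈ S, root u ↔ root' u) :
    rootedOrientations adj root S = rootedOrientations adj root' S := by
  ext r
  rw [mem_rootedOrientations, mem_rootedOrientations]
  grind

/-- A configuration on the graph with vertex set `V`: a subset `S` of `V` containing `v` and with
independent complement, and an acyclic orientation of `S` with unique source `v`. -/
def IsConfiguration (adj : α → α → Prop) (V : Finset α) (v : α)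
    (p : Finset α × Finset (α × α)) : Prop :=
  p.1 ⊆ V ∧ v ∈ p.1 ∧ (∀ u ∈ V \ p.1, ∀ w ∈ V \ p.1, ¬ adj u w) ∧
    p.2 ∈ rootedOrientations adj (· = v) p.1

/-- The vertices which can change sides in a configuration `(S, r)`: the vertices outside `S` with
a neighbour in `S`, and the sinks of `S` other than `v` with no neighbour outside `S`. -/
def IsMovable (adj : α → α → Prop) (V : Finset α) (v : α) (p : Finset α × Finset (α × α))
    (x : α) : Prop :=
  (x ∈ V \ p.1 ∧ ∃ u ∈ p.1, adj u x) ∨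
    (x ∈ p.1 ∧ x ≠ v ∧ (∀ w, (x, w) ∉ p.2) ∧ ∀ t ∈ V \ p.1, ¬ adj t x)

open scoped Classical in
/-- Move `x` to the other side of a configuration: remove `x` from `S`, or insert it as a sink. -/
noncomputable def flipVertex (adj : α → α → Prop) (x : α) (p : Finset α × Finset (α × α)) :
    Finset α × Finset (α × α) :=
  if x ∈ p.1 then (p.1.erase x, {e ∈ p.2 | e.2 ≠ x})
  else (insert x p.1, p.2 ∪ ({u ∈ p.1 | adj u x} ×ˢ {x}))

lemma isConfiguration_flip (hsymm : ∀ u w, adj u w → adj w u) (hirr : ∀ u, ¬ adj u u)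
    {p : Finset α × Finset (α × α)} (hp : IsConfiguration adj V v p) {x : α}
    (hx : IsMovable adj V v p x) : IsConfiguration adj V v (flipVertex adj x p) := by
  obtain ⟨S, r⟩ := p
  obtain ⟨hSV, hv, hind, hr⟩ := hp
  rw [mem_rootedOrientations] at hr
  obtain ⟨hsub, hadj, hac, hsrc⟩ := hr
  simp only at hSV hv hind hsub hadj hac hsrc
  have hsub' : ∀ a b, (a, b) ∈ r → a ∈ S ∧ b ∈ S := fun a b h => by simpa using hsub h
  rcases hx with ⟨hxS, u₀, hu₀, hux⟩ | ⟨hxS, hxv, hsink, hnt⟩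
  · simp only [Finset.mem_sdiff] at hxS hu₀
    have hmem : ∀ a b, (a, b) ∈ (flipVertex adj x (S, r)).2 ↔
        (a, b) ∈ r ∨ (a ∈ S ∧ adj a x ∧ b = x) := by
      intro a b
      simp [flipVertex, hxS.2, and_assoc, eq_comm (a := x)]
    have hS : (flipVertex adj x (S, r)).1 = insert x S := by simp [flipVertex, hxS.2]
    refine ⟨?_, ?_, ?_, ?_⟩
    · rw [hS]; grind
    · rw [hS]; grind
    · rw [hS]; grind
    · rw [mem_rootedOrientations, hS]
      refine ⟨?_, ?_, ?_, ?_⟩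
      · rintro ⟨a, b⟩ h
        rw [hmem] at h
        rw [Finset.mem_product]
        grind
      · intro a ha b hb
        rw [hmem, hmem]
        grind
      · -- a path not ending at `x` avoids `x`, since `x` has no outgoing arrow
        have key : ∀ a b, Relation.TransGen (fun y z => (y, z) ∈ (flipVertex adj x (S, r)).2) a b →
            b ≠ x → Relation.TransGen (fun y z => (y, z) ∈ r) a b := by
          intro a b h
          induction h with
          | single h =>
            intro hb
            rw [hmem] at h
            exact .single (by grind)
          | tail _ h ih =>
            intro hb
            rw [hmem] at h
            exact .tail (ih (by grind)) (by grind)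
        intro a ha
        by_cases hax : a = x
        · subst hax
          obtain ⟨c, hc, -⟩ := Relation.TransGen.head'_iff.mp ha
          rw [hmem] at hc
          grind
        · exact hac a (key a a ha hax)
      · intro a ha
        simp only [hmem]
        grind
  · have hmem : ∀ a b, (a, b) ∈ (flipVertex adj x (S, r)).2 ↔ (a, b) ∈ r ∧ b ≠ x := by
      intro a b
      simp [flipVertex, show x ∈ S from hxS]
    have hS : (flipVertex adj x (S, r)).1 = S.erase x := by simp [flipVertex, show x ∈ S from hxS]
    simp only at hxS hsink hnt
    refine ⟨?_, ?_, ?_, ?_⟩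
    · rw [hS]; grind
    · rw [hS]; grind
    · rw [hS]; grind
    · rw [mem_rootedOrientations, hS]
      refine ⟨?_, ?_, ?_, ?_⟩
      · rintro ⟨a, b⟩ h
        rw [hmem] at h
        rw [Finset.mem_product]
        grind
      · intro a ha b hb
        rw [hmem, hmem]
        grind
      · intro a ha
        exact hac a (Relation.TransGen.mono (fun y z h => ((hmem y z).mp h).1) a a ha)
      · intro a ha
        simp only [hmem]
        grind

lemma isMovable_flip_iff (hsymm : ∀ u w, adj u w → adj w u) (hirr : ∀ u, ¬ adj u u)
    {p : Finset α × Finset (α × α)} (hp : IsConfiguration adj V v p) {x : α}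
    (hx : IsMovable adj V v p x) (y : α) :
    IsMovable adj V v (flipVertex adj x p) y ↔ IsMovable adj V v p y := by
  obtain ⟨S, r⟩ := p
  obtain ⟨hSV, hv, hind, hr⟩ := hp
  rw [mem_rootedOrientations] at hr
  obtain ⟨hsub, hadj, hac, hsrc⟩ := hr
  simp only at hSV hv hind hsub hadj hac hsrc
  have hsub' : ∀ a b, (a, b) ∈ r → a ∈ S ∧ b ∈ S := fun a b h => by simpa using hsub h
  rcases hx with ⟨hxS, u₀, hu₀, hux⟩ | ⟨hxS, hxv, hsink, hnt⟩
  · simp only [Finset.mem_sdiff] at hxS hu₀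
    have hmem : ∀ a b, (a, b) ∈ (flipVertex adj x (S, r)).2 ↔
        (a, b) ∈ r ∨ (a ∈ S ∧ adj a x ∧ b = x) := by
      intro a b
      simp [flipVertex, hxS.2, and_assoc, eq_comm (a := x)]
    have hS : (flipVertex adj x (S, r)).1 = insert x S := by simp [flipVertex, hxS.2]
    simp only [IsMovable, hS, hmem]
    grind
  · have hmem : ∀ a b, (a, b) ∈ (flipVertex adj x (S, r)).2 ↔ (a, b) ∈ r ∧ b ≠ x := by
      intro a b
      simp [flipVertex, show x ∈ S from hxS]
    have hS : (flipVertex adj x (S, r)).1 = S.erase x := by simp [flipVertex, show x ∈ S from hxS]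
    simp only at hxS hsink hnt
    simp only [IsMovable, hS, hmem]
    grind

lemma flip_flip (hsymm : ∀ u w, adj u w → adj w u)
    {p : Finset α × Finset (α × α)} (hp : IsConfiguration adj V v p) {x : α}
    (hx : IsMovable adj V v p x) : flipVertex adj x (flipVertex adj x p) = p := by
  obtain ⟨S, r⟩ := p
  obtain ⟨hSV, hv, hind, hr⟩ := hp
  rw [mem_rootedOrientations] at hr
  obtain ⟨hsub, hadj, hac, hsrc⟩ := hr
  simp only at hSV hv hind hsub hadj hac hsrc
  have hsub' : ∀ a b, (a, b) ∈ r → a ∈ S ∧ b ∈ S := fun a b h => by simpa using hsub h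
  rcases hx with ⟨hxS, u₀, hu₀, hux⟩ | ⟨hxS, hxv, hsink, hnt⟩
  · simp only [Finset.mem_sdiff] at hxS hu₀
    simp only [flipVertex, hxS.2, if_false, Finset.mem_insert_self, if_true]
    refine Prod.ext (Finset.erase_insert hxS.2) ?_
    ext ⟨a, b⟩
    simp
    grind
  · simp only at hxS hsink hnt
    simp only [flipVertex, hxS, if_true, Finset.notMem_erase, if_false]
    refine Prod.ext (Finset.insert_erase hxS) ?_
    ext ⟨a, b⟩
    simp
    grind

/-- In an acyclic orientation with unique source `v`, there is a sink other than `v` unless `v` is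
the only vertex. -/
lemma exists_sink {r : Finset (α × α)} (hr : r ∈ rootedOrientations adj (· = v) S)
    (hv : v ∈ S) (hS : ∃ u ∈ S, u ≠ v) : ∃ u ∈ S, u ≠ v ∧ ∀ w, (u, w) ∉ r := by
  obtain ⟨hsub, -, hac, hsrc⟩ := mem_rootedOrientations.mp hr
  obtain ⟨u, hu, hmin⟩ := exists_mem_forall_not_rel (ρ := fun x y => (y, x) ∈ r)
    (fun u h => hac u (Relation.transGen_swap.mp h)) (T := S.erase v)
    (by obtain ⟨u, hu, huv⟩ := hS; exact ⟨u, by simp [hu, huv]⟩)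
  rw [Finset.mem_erase] at hu
  refine ⟨u, hu.2, hu.1, fun w hw => hmin w (Finset.mem_erase.mpr ⟨?_, ?_⟩) hw⟩
  · rintro rfl
    exact (hsrc w hv).mpr rfl u hw
  · exact (Finset.mem_product.mp (hsub hw)).2

/-- A configuration without movable vertex exists only on an edgeless graph. -/
lemma exists_isMovable {p : Finset α × Finset (α × α)} (hp : IsConfiguration adj V v p)
    (hsymm : ∀ u w, adj u w → adj w u) (hV : ¬ ∀ u ∈ V, ∀ w ∈ V, ¬ adj u w) :
    ∃ x, IsMovable adj V v p x := by
  obtain ⟨S, r⟩ := p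
  by_contra! hno
  obtain ⟨hSV, hv, hind, hr⟩ := hp
  simp only at hSV hv hind hr
  simp only [IsMovable, not_or] at hno
  by_cases hS : ∃ u ∈ S, u ≠ v
  · obtain ⟨u, hu, huv, hs⟩ := exists_sink hr hv hS
    have h1 := hno u
    grind
  · rw [mem_rootedOrientations] at hr
    obtain ⟨hsub, hadj, hac, hsrc⟩ := hr
    have hvv : ¬ adj v v := by
      rw [hadj v hv v hv]
      rintro (h | h) <;> exact hac v (.single h)
    grind

/-- On an edgeless graph, `{v}` with no arrow is the only configuration. -/
lemma isConfiguration_iff_of_edgeless (hvV : v ∈ V) (hV : ∀ u ∈ V, ∀ w ∈ V, ¬ adj u w)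
    (p : Finset α × Finset (α × α)) : IsConfiguration adj V v p ↔ p = ({v}, ∅) := by
  obtain ⟨S, r⟩ := p
  rw [IsConfiguration, mem_rootedOrientations]
  constructor
  · rintro ⟨hSV, hv, hind, hsub, hadj, hac, hsrc⟩
    simp only at hSV hv hind hsub hadj hac hsrc
    have hr : r = ∅ := by
      refine Finset.eq_empty_of_forall_notMem fun e he => ?_
      have h := Finset.mem_product.mp (hsub he)
      exact hV _ (hSV h.1) _ (hSV h.2) ((hadj _ h.1 _ h.2).mpr (.inl he))
    subst hr
    have hS : S = {v} := by
      refine Finset.eq_singleton_iff_unique_mem.mpr ⟨hv, fun u hu => ?_⟩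
      exact (hsrc u hu).mp (by simp)
    rw [hS]
  · intro h
    rw [Prod.mk.injEq] at h
    obtain ⟨rfl, rfl⟩ := h
    refine ⟨by simpa, by simp, by grind, by simp, ?_, ?_, ?_⟩
    · simpa using hV v hvV v hvV
    · intro u h
      obtain ⟨c, hc, -⟩ := Relation.TransGen.head'_iff.mp h
      simp at hc
    · simp

open scoped Classical in
/-- Sign-reversing involution on configurations: a movable vertex, chosen as a function of the set
of movable vertices, changes sides. -/
lemma sum_isConfiguration (hsymm : ∀ u w, adj u w → adj w u) (hirr : ∀ u, ¬ adj u u)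
    (hvV : v ∈ V) :
    ∑ p ∈ V.powerset ×ˢ (V ×ˢ V).powerset with IsConfiguration adj V v p,
      (-1 : ℝ) ^ (p.1.card + 1) = if ∀ u ∈ V, ∀ w ∈ V, ¬ adj u w then 1 else 0 := by
  have hmemV : ∀ {p}, IsConfiguration adj V v p → p ∈ V.powerset ×ˢ (V ×ˢ V).powerset := by
    rintro ⟨S, r⟩ ⟨hS, -, -, hr⟩
    rw [Finset.mem_product, Finset.mem_powerset, Finset.mem_powerset]
    exact ⟨hS, (mem_rootedOrientations.mp hr).1.trans (Finset.product_subset_product hS hS)⟩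
  split_ifs with hV
  · have : (V.powerset ×ˢ (V ×ˢ V).powerset).filter (IsConfiguration adj V v) =
        {(({v}, ∅) : Finset α × Finset (α × α))} := by
      ext p
      rw [Finset.mem_filter, Finset.mem_singleton, ← isConfiguration_iff_of_edgeless hvV hV]
      exact ⟨fun h => h.2, fun h => ⟨hmemV h, h⟩⟩
    rw [this]
    simp
  · have hex : ∀ p, p ∈ (V.powerset ×ˢ (V ×ˢ V).powerset).filter (IsConfiguration adj V v) →
        ∃ x, IsMovable adj V v p x :=
      fun p hp => exists_isMovable (Finset.mem_filter.mp hp).2 hsymm hV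
    let pick : (α → Prop) → α := fun P => if h : ∃ x, P x then h.choose else v
    have hpick : ∀ P : α → Prop, (∃ x, P x) → P (pick P) := by
      intro P h
      simp only [pick, dif_pos h]
      exact h.choose_spec
    have hstable : ∀ p, p ∈ (V.powerset ×ˢ (V ×ˢ V).powerset).filter (IsConfiguration adj V v) →
        ∀ x, IsMovable adj V v p x → IsMovable adj V v (flipVertex adj x p) = IsMovable adj V v p :=
      fun p hp x hx => funext fun y =>
        propext (isMovable_flip_iff hsymm hirr (Finset.mem_filter.mp hp).2 hx y)
    have hcard : ∀ p x,
        (-1 : ℝ) ^ (p.1.card + 1) + (-1) ^ ((flipVertex adj x p).1.card + 1) = 0 := by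
      intro p x
      by_cases h : x ∈ p.1
      · simp only [flipVertex, h, if_true]
        rw [← Finset.card_erase_add_one h]
        ring
      · simp only [flipVertex, h, if_false, Finset.card_insert_of_notMem h]
        ring
    refine Finset.sum_involution (fun p _ => flipVertex adj (pick (IsMovable adj V v p)) p)
      (fun p hp => hcard p _) (fun p hp hne h => ?_) (fun p hp => ?_) (fun p hp => ?_)
    · have := hcard p (pick (IsMovable adj V v p))
      rw [h] at this
      exact hne (by linarith)
    · have hc := isConfiguration_flip hsymm hirr (Finset.mem_filter.mp hp).2
        (hpick _ (hex p hp))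
      exact Finset.mem_filter.mpr ⟨hmemV hc, hc⟩
    · rw [hstable p hp _ (hpick _ (hex p hp))]
      exact flip_flip hsymm (Finset.mem_filter.mp hp).2 (hpick _ (hex p hp))

open scoped Classical in
/-- An alternating sum over the vertex sets containing `v`, with independent complement, of the
number of acyclic orientations with unique source `v`, detects edgeless graphs. -/
theorem sum_card_rootedOrientations (hsymm : ∀ u w, adj u w → adj w u) (hirr : ∀ u, ¬ adj u u)
    (hvV : v ∈ V) :
    ∑ S ∈ V.powerset with v ∈ S ∧ ∀ u ∈ V \ S, ∀ w ∈ V \ S, ¬ adj u w,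
      (-1 : ℝ) ^ (S.card + 1) * (rootedOrientations adj (· = v) S).card =
        if ∀ u ∈ V, ∀ w ∈ V, ¬ adj u w then 1 else 0 := by
  rw [← sum_isConfiguration hsymm hirr hvV]
  simp_rw [mul_comm _ ((rootedOrientations adj (· = v) _).card : ℝ), ← nsmul_eq_mul,
    ← Finset.sum_const]
  rw [Finset.sum_sigma']
  refine Finset.sum_bij' (fun p _ => (p.1, p.2)) (fun p _ => ⟨p.1, p.2⟩) ?_ ?_ ?_ ?_ ?_
  · rintro ⟨S, r⟩ h
    simp only [Finset.mem_sigma, Finset.mem_filter, Finset.mem_powerset] at h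
    simp only [Finset.mem_filter, Finset.mem_product, Finset.mem_powerset]
    exact ⟨⟨h.1.1, (mem_rootedOrientations.mp h.2).1.trans
      (Finset.product_subset_product h.1.1 h.1.1)⟩, h.1.1, h.1.2.1, h.1.2.2, h.2⟩
  · rintro ⟨S, r⟩ h
    simp only [Finset.mem_filter] at h
    simp only [Finset.mem_sigma, Finset.mem_filter, Finset.mem_powerset]
    exact ⟨⟨h.2.1, h.2.2.1, h.2.2.2.1⟩, h.2.2.2.2⟩
  · intros; rfl
  · intros; rfl
  · intros; rfl

end

/-! ### Matchings -/

/-- The matchings of `A`: partitions of `A` into blocks of size `2`, encoded as their set of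
blocks. -/
def matchings (A : Finset ℕ) : Finset (Finset (Finset ℕ)) :=
  {P ∈ A.powerset.powerset | (∀ b ∈ P, b.card = 2) ∧
    (∀ b ∈ P, ∀ c ∈ P, b ≠ c → Disjoint b c) ∧ P.biUnion id = A}

/-- Adjacency in the crossing graph, as a relation on arbitrary finite sets of integers. -/
def Crosses (x y : Finset ℕ) : Prop := CrossesLeft x y ∨ CrossesLeft y x

/-- No two of the given blocks cross. -/
def IsNoncrossing (P : Finset (Finset ℕ)) : Prop := ∀ u ∈ P, ∀ w ∈ P, ¬ Crosses u w

open scoped Classical in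
/-- The noncrossing matchings of `A`. -/
noncomputable def noncrossingMatchings (A : Finset ℕ) : Finset (Finset (Finset ℕ)) :=
  {P ∈ matchings A | IsNoncrossing P}

section

variable {A : Finset ℕ} {P : Finset (Finset ℕ)}

lemma mem_matchings : P ∈ matchings A ↔ (∀ b ∈ P, b.card = 2) ∧
    (∀ b ∈ P, ∀ c ∈ P, ∀ z ∈ b, z ∈ c → b = c) ∧ ∀ z, z ∈ A ↔ ∃ b ∈ P, z ∈ b := by
  have h3 : P.biUnion id = A ↔ ∀ z, z ∈ A ↔ ∃ b ∈ P, z ∈ b := by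
    rw [Finset.ext_iff]
    simp [iff_comm]
  have h2 : (∀ b ∈ P, ∀ c ∈ P, b ≠ c → Disjoint b c) ↔
      ∀ b ∈ P, ∀ c ∈ P, ∀ z ∈ b, z ∈ c → b = c := by
    simp only [Finset.disjoint_left]
    grind
  rw [matchings, Finset.mem_filter, h2, h3, Finset.mem_powerset]
  refine ⟨fun h => h.2, fun h => ⟨fun b hb => ?_, h⟩⟩
  exact Finset.mem_powerset.mpr fun z hz => (h.2.2 z).mpr ⟨b, hb, hz⟩

lemma mem_noncrossingMatchings :
    P ∈ noncrossingMatchings A ↔ P ∈ matchings A ∧ IsNoncrossing P := by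
  simp [noncrossingMatchings]

lemma Crosses.symm {x y : Finset ℕ} (h : Crosses x y) : Crosses y x := Or.symm h

lemma crossesLeft_iff {x y : Finset ℕ} : CrossesLeft x y ↔
    ∃ i j k l : ℕ, (∀ z, z ∈ x ↔ z = i ∨ z = j) ∧ (∀ z, z ∈ y ↔ z = k ∨ z = l) ∧
      i < k ∧ k < j ∧ j < l := by
  simp [CrossesLeft, Finset.ext_iff]

lemma not_crosses_self (x : Finset ℕ) : ¬ Crosses x x := by
  simp only [Crosses, crossesLeft_iff, or_self]
  rintro ⟨i, j, k, l, hx, hx', h1, h2, h3⟩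
  have := (hx k).mp ((hx' k).mpr (.inl rfl))
  omega

lemma not_crosses_of_lt_of_lt {x y : Finset ℕ} (h : ∀ z ∈ x, ∀ w ∈ y, z < w) :
    ¬ Crosses x y := by
  rintro (h' | h') <;> obtain ⟨i, j, k, l, hx, hy, h1, h2, h3⟩ := crossesLeft_iff.mp h'
  · have := h j ((hx j).mpr (.inr rfl)) k ((hy k).mpr (.inl rfl))
    omega
  · have := h k ((hy k).mpr (.inl rfl)) i ((hx i).mpr (.inl rfl))
    omega

lemma crosses_of_lt {a b x y : ℕ} (h1 : a < x) (h2 : x < b) (h3 : b < y) :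
    Crosses {a, b} {x, y} := .inl ⟨a, b, x, y, rfl, rfl, h1, h2, h3⟩

/-- A block lying between the two elements of `{a, b}` does not cross it. -/
lemma not_crosses_of_between {a b : ℕ} {y : Finset ℕ} (h : ∀ w ∈ y, a < w ∧ w < b) :
    ¬ Crosses {a, b} y := by
  rintro (h' | h') <;> obtain ⟨i, j, k, l, hx, hy, h1, h2, h3⟩ := crossesLeft_iff.mp h'
  · have := h k ((hy k).mpr (.inl rfl))
    have := h l ((hy l).mpr (.inr rfl))
    have := (hx i).mpr (.inl rfl)
    have := (hx j).mpr (.inr rfl)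
    grind
  · have := h i ((hx i).mpr (.inl rfl))
    have := h j ((hx j).mpr (.inr rfl))
    have := (hy k).mpr (.inl rfl)
    have := (hy l).mpr (.inr rfl)
    grind

lemma matchings_empty : matchings ∅ = {∅} := by
  ext P
  rw [mem_matchings, Finset.mem_singleton]
  constructor
  · rintro ⟨h1, -, h3⟩
    refine Finset.eq_empty_of_forall_notMem fun b hb => ?_
    obtain ⟨z, hz⟩ := Finset.card_pos.mp (by rw [h1 b hb]; norm_num : 0 < b.card)
    exact absurd ((h3 z).mpr ⟨b, hb, hz⟩) (by simp)
  · rintro rfl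
    simp

end

/-- Splitting a matching into two parts, the first of which covers `a`, amounts to matching
separately a subset containing `a` and its complement. -/
lemma sum_matchings_split {M : Type*} [AddCommMonoid M] (A : Finset ℕ) (a : ℕ)
    (F : Finset (Finset ℕ) → Finset (Finset ℕ) → M) :
    ∑ B ∈ A.powerset with a ∈ B, ∑ P ∈ matchings B, ∑ Q ∈ matchings (A \ B), F P Q =
      ∑ R ∈ matchings A, ∑ S ∈ R.powerset with a ∈ S.biUnion id, F S (R \ S) := by
  simp only [Finset.sum_sigma']
  refine Finset.sum_bij' (fun t _ => ⟨t.2.1 ∪ t.2.2, t.2.1⟩)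
    (fun t _ => ⟨t.2.biUnion id, t.2, t.1 \ t.2⟩) ?_ ?_ ?_ ?_ ?_
  · rintro ⟨B, P, Q⟩ h
    simp only [Finset.mem_sigma, Finset.mem_filter, Finset.mem_powerset, mem_matchings,
      Finset.mem_biUnion, id, Finset.mem_sdiff] at h ⊢
    obtain ⟨⟨hBA, haB⟩, ⟨hP1, hP2, hP3⟩, hQ1, hQ2, hQ3⟩ := h
    refine ⟨⟨?_, ?_, ?_⟩, Finset.subset_union_left, (hP3 a).mp haB⟩
    · grind
    · grind
    · grind
  · rintro ⟨R, S⟩ h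
    simp only [Finset.mem_sigma, Finset.mem_filter, Finset.mem_powerset, mem_matchings,
      Finset.mem_biUnion, id, Finset.mem_sdiff] at h ⊢
    obtain ⟨⟨hR1, hR2, hR3⟩, hSR, haS⟩ := h
    refine ⟨⟨?_, haS⟩, ⟨?_, ?_, ?_⟩, ?_, ?_, ?_⟩
    · intro z hz
      simp only [Finset.mem_biUnion, id] at hz
      grind
    · grind
    · grind
    · grind
    · grind
    · grind
    · grind
  · rintro ⟨B, P, Q⟩ h
    simp only [Finset.mem_sigma, Finset.mem_filter, Finset.mem_powerset, mem_matchings,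
      Finset.mem_sdiff] at h ⊢
    obtain ⟨⟨hBA, haB⟩, ⟨hP1, hP2, hP3⟩, hQ1, hQ2, hQ3⟩ := h
    have hB : P.biUnion id = B := by
      ext z
      rw [Finset.mem_biUnion]
      exact (hP3 z).symm
    have hQ : (P ∪ Q) \ P = Q := by
      refine Finset.union_sdiff_cancel_left (Finset.disjoint_left.mpr fun b hb hb' => ?_)
      obtain ⟨z, hz⟩ := Finset.card_pos.mp (by rw [hP1 b hb]; norm_num : 0 < b.card)
      grind
    rw [hB, hQ]
  · rintro ⟨R, S⟩ h
    simp only [Finset.mem_sigma, Finset.mem_filter, Finset.mem_powerset] at h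
    simp only [Finset.union_sdiff_of_subset h.2.1]
  · rintro ⟨B, P, Q⟩ h
    simp only [Finset.mem_sigma, Finset.mem_filter, Finset.mem_powerset, mem_matchings,
      Finset.mem_sdiff] at h
    obtain ⟨⟨hBA, haB⟩, ⟨hP1, hP2, hP3⟩, hQ1, hQ2, hQ3⟩ := h
    have hQ : (P ∪ Q) \ P = Q := by
      refine Finset.union_sdiff_cancel_left (Finset.disjoint_left.mpr fun b hb hb' => ?_)
      obtain ⟨z, hz⟩ := Finset.card_pos.mp (by rw [hP1 b hb]; norm_num : 0 < b.card)
      grind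
    simp only [hQ]

/-- Reindexing of a sum over `B` by the rank of the elements of `B`. -/
lemma sum_card_filter_lt {M : Type*} [AddCommMonoid M] (B : Finset ℕ) (f : ℕ → ℕ → M) :
    ∑ b ∈ B, f (B.filter (· < b)).card (B.filter (b < ·)).card =
      ∑ i ∈ Finset.range B.card, f i (B.card - 1 - i) := by
  have hcard : ∀ b ∈ B, (B.filter (· < b)).card + (B.filter (b < ·)).card + 1 = B.card := by
    intro b hb
    rw [← Finset.card_union_of_disjoint (Finset.disjoint_filter.mpr fun _ _ _ => by omega),
      ← Finset.card_insert_of_notMem (a := b) (by simp)]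
    congr 1
    grind
  have hmono : ∀ b ∈ B, ∀ c ∈ B, b < c →
      (B.filter (· < b)).card < (B.filter (· < c)).card := by
    intro b hb c hc hbc
    refine Finset.card_lt_card (Finset.ssubset_iff_of_subset ?_ |>.mpr ⟨b, ?_, ?_⟩) <;> grind
  have hinj : Set.InjOn (fun b => (B.filter (· < b)).card) B := by
    intro b hb c hc h
    simp only at h
    by_contra hne
    rcases Nat.lt_or_gt_of_ne hne with h' | h'
    · have := hmono b hb c hc h'; omega
    · have := hmono c hc b hb h'; omega
  have himg : B.image (fun b => (B.filter (· < b)).card) = Finset.range B.card := by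
    refine Finset.eq_of_subset_of_card_le (fun i hi => ?_) ?_
    · obtain ⟨b, hb, rfl⟩ := Finset.mem_image.mp hi
      have := hcard b hb
      simp only [Finset.mem_range]
      omega
    · rw [Finset.card_image_of_injOn hinj, Finset.card_range]
  rw [← himg, Finset.sum_image hinj]
  refine Finset.sum_congr rfl fun b hb => ?_
  rw [← hcard b hb]
  congr 1
  omega

/-! ### Noncrossing matchings -/

/-- A noncrossing matching is determined by the partner `b` of the smallest element and by
noncrossing matchings of the elements before and after `b`. -/
lemma card_noncrossingMatchings_insert {a : ℕ} {B : Finset ℕ} (ha : ∀ b ∈ B, a < b) :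
    (noncrossingMatchings (insert a B)).card = ∑ b ∈ B,
      (noncrossingMatchings (B.filter (· < b))).card *
        (noncrossingMatchings (B.filter (b < ·))).card := by
  simp_rw [← Finset.card_product]
  rw [← Finset.card_sigma]
  symm
  refine Finset.card_bij (fun t _ => insert {a, t.1} (t.2.1 ∪ t.2.2)) ?_ ?_ ?_
  · rintro ⟨b, P, Q⟩ h
    simp only [Finset.mem_sigma, Finset.mem_product, mem_noncrossingMatchings, mem_matchings,
      Finset.mem_filter] at h
    obtain ⟨hb, ⟨⟨hP1, hP2, hP3⟩, hP4⟩, ⟨hQ1, hQ2, hQ3⟩, hQ4⟩ := h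
    have hab := ha b hb
    rw [mem_noncrossingMatchings, mem_matchings]
    have hPb : ∀ y ∈ P, ∀ w ∈ y, a < w ∧ w < b := by grind
    have hQb : ∀ y ∈ Q, ∀ w ∈ y, b < w := by grind
    refine ⟨⟨?_, ?_, ?_⟩, ?_⟩
    · have := Finset.card_pair hab.ne
      grind
    · intro x hx y hy z hzx hzy
      simp only [Finset.mem_insert, Finset.mem_union] at hx hy
      rcases hx with rfl | hx | hx <;> rcases hy with rfl | hy | hy
      · rfl
      · have := hPb y hy z hzy; grind
      · have := hQb y hy z hzy; grind
      · have := hPb x hx z hzx; grind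
      · exact hP2 x hx y hy z hzx hzy
      · have := hPb x hx z hzx; have := hQb y hy z hzy; omega
      · have := hQb x hx z hzx; grind
      · have := hQb x hx z hzx; have := hPb y hy z hzy; omega
      · exact hQ2 x hx y hy z hzx hzy
    · grind
    · have h1 : ∀ y ∈ P, ¬ Crosses {a, b} y := fun y hy => not_crosses_of_between (hPb y hy)
      have h2 : ∀ y ∈ Q, ¬ Crosses {a, b} y := fun y hy =>
        not_crosses_of_lt_of_lt (by grind)
      have h3 : ∀ x ∈ P, ∀ y ∈ Q, ¬ Crosses x y := fun x hx y hy =>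
        not_crosses_of_lt_of_lt (by grind)
      intro u hu w hw hcr
      have hcr' := hcr.symm
      have := not_crosses_self u
      have := hP4 u
      have := hQ4 u
      simp only [Finset.mem_insert, Finset.mem_union] at hu hw
      rcases hu with rfl | hu | hu <;> rcases hw with rfl | hw | hw <;> grind
  · rintro ⟨b, P, Q⟩ h ⟨b', P', Q'⟩ h' heq
    simp only [Finset.mem_sigma, Finset.mem_product, mem_noncrossingMatchings, mem_matchings,
      Finset.mem_filter] at h h'
    obtain ⟨hb, ⟨⟨hP1, hP2, hP3⟩, hP4⟩, ⟨hQ1, hQ2, hQ3⟩, hQ4⟩ := h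
    obtain ⟨hb', ⟨⟨hP1', hP2', hP3'⟩, hP4'⟩, ⟨hQ1', hQ2', hQ3'⟩, hQ4'⟩ := h'
    simp only at heq
    have hPb : ∀ y ∈ P, ∀ w ∈ y, a < w ∧ w < b := by grind
    have hQb : ∀ y ∈ Q, ∀ w ∈ y, b < w := by grind
    have hPb' : ∀ y ∈ P', ∀ w ∈ y, a < w ∧ w < b' := by grind
    have hQb' : ∀ y ∈ Q', ∀ w ∈ y, b' < w := by grind
    have hab := ha b hb
    have hab' := ha b' hb'
    have hbb : b = b' := by
      have h1 : ({a, b} : Finset ℕ) ∈ insert {a, b'} (P' ∪ Q') := by rw [← heq]; simp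
      simp only [Finset.mem_insert, Finset.mem_union] at h1
      rcases h1 with h1 | h1 | h1
      · have : b ∈ ({a, b'} : Finset ℕ) := by rw [← h1]; simp
        grind
      · have := hPb' _ h1 a (by simp); omega
      · have := hQb' _ h1 a (by simp); omega
    subst hbb
    have hne : ∀ R : Finset (Finset ℕ), (∀ y ∈ R, y.card = 2) → ∀ y ∈ R, ∃ z, z ∈ y :=
      fun R hR y hy => Finset.card_pos.mp (by rw [hR y hy]; norm_num)
    have heq' := fun y => Finset.ext_iff.mp heq y
    simp only [Finset.mem_insert, Finset.mem_union] at heq'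
    have hPP : P = P' := by
      ext y
      have := heq' y
      have := hne P hP1 y
      have := hne P' hP1' y
      have : a ∈ ({a, b} : Finset ℕ) := by simp
      grind
    have hQQ : Q = Q' := by
      ext y
      have := heq' y
      have := hne Q hQ1 y
      have := hne Q' hQ1' y
      have : a ∈ ({a, b} : Finset ℕ) := by simp
      grind
    rw [hPP, hQQ]
  · intro R hR
    rw [mem_noncrossingMatchings, mem_matchings] at hR
    obtain ⟨⟨hR1, hR2, hR3⟩, hR4⟩ := hR
    obtain ⟨c, hc, hac⟩ := (hR3 a).mp (Finset.mem_insert_self a B)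
    obtain ⟨b, hcb⟩ : ∃ b, c = {a, b} := by
      obtain ⟨x, y, -, rfl⟩ := Finset.card_eq_two.mp (hR1 c hc)
      rcases Finset.mem_insert.mp hac with h | h
      · exact ⟨y, by rw [h]⟩
      · exact ⟨x, by rw [Finset.mem_singleton.mp h, Finset.pair_comm]⟩
    subst hcb
    have hba : b ≠ a := by
      rintro rfl
      simpa using hR1 _ hc
    have hbB : b ∈ B := by
      have := (hR3 b).mpr ⟨_, hc, by simp⟩
      grind
    have hab := ha b hbB
    -- the other blocks lie on one side of `b`, since they do not cross `{a, b}`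
    have hside : ∀ y ∈ R, y ≠ {a, b} → (∀ w ∈ y, a < w ∧ w < b) ∨ ∀ w ∈ y, b < w := by
      intro y hy hne
      obtain ⟨p, q, hpq, rfl⟩ := Finset.card_eq_two.mp (hR1 y hy)
      have hp : p ≠ a ∧ p ≠ b := by
        constructor <;> rintro rfl <;>
          exact hne (hR2 _ hy _ hc p (by simp) (by simp))
      have hq : q ≠ a ∧ q ≠ b := by
        constructor <;> rintro rfl <;>
          exact hne (hR2 _ hy _ hc q (by simp) (by simp))
      have hpB : a < p := ha p (by have := (hR3 p).mpr ⟨_, hy, by simp⟩; grind)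
      have hqB : a < q := ha q (by have := (hR3 q).mpr ⟨_, hy, by simp⟩; grind)
      have h1 : ¬ (p < b ∧ b < q) := fun h => hR4 _ hc _ hy (crosses_of_lt hpB h.1 h.2)
      have h2 : ¬ (q < b ∧ b < p) := fun h =>
        hR4 _ hc _ hy (by rw [Finset.pair_comm p q]; exact crosses_of_lt hqB h.1 h.2)
      simp only [Finset.mem_insert, Finset.mem_singleton, forall_eq_or_imp, forall_eq]
      omega
    have hne : ∀ y ∈ R, ∃ z, z ∈ y :=
      fun y hy => Finset.card_pos.mp (by rw [hR1 y hy]; norm_num)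
    refine ⟨⟨b, {y ∈ R | ∀ w ∈ y, a < w ∧ w < b}, {y ∈ R | ∀ w ∈ y, b < w}⟩, ?_, ?_⟩
    · simp only [Finset.mem_sigma, Finset.mem_product, mem_noncrossingMatchings, mem_matchings,
        Finset.mem_filter, IsNoncrossing]
      refine ⟨hbB, ⟨⟨?_, ?_, ?_⟩, ?_⟩, ⟨?_, ?_, ?_⟩, ?_⟩
      · grind
      · grind
      · intro z
        constructor
        · rintro ⟨hz, hzb⟩
          obtain ⟨y, hy, hzy⟩ := (hR3 z).mp (Finset.mem_insert_of_mem hz)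
          have := ha z hz
          have hyne : y ≠ {a, b} := by grind
          rcases hside y hy hyne with h | h
          · exact ⟨y, ⟨hy, h⟩, hzy⟩
          · have := h z hzy; omega
        · rintro ⟨y, ⟨hy, h⟩, hzy⟩
          have hlt := h z hzy
          exact ⟨Finset.mem_of_mem_insert_of_ne ((hR3 z).mpr ⟨y, hy, hzy⟩) (by omega), by omega⟩
      · intro u hu w hw
        exact hR4 u hu.1 w hw.1
      · grind
      · grind
      · intro z
        constructor
        · rintro ⟨hz, hzb⟩
          obtain ⟨y, hy, hzy⟩ := (hR3 z).mp (Finset.mem_insert_of_mem hz)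
          have := ha z hz
          have hyne : y ≠ {a, b} := by grind
          rcases hside y hy hyne with h | h
          · have := h z hzy; omega
          · exact ⟨y, ⟨hy, h⟩, hzy⟩
        · rintro ⟨y, ⟨hy, h⟩, hzy⟩
          have hlt := h z hzy
          exact ⟨Finset.mem_of_mem_insert_of_ne ((hR3 z).mpr ⟨y, hy, hzy⟩) (by omega), by omega⟩
      · intro u hu w hw
        exact hR4 u hu.1 w hw.1
    · ext y
      simp only [Finset.mem_insert, Finset.mem_union, Finset.mem_filter]
      constructor
      · rintro (rfl | h | h)
        · exact hc
        · exact h.1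
        · exact h.1
      · intro hy
        by_cases hyne : y = {a, b}
        · exact .inl hyne
        · rcases hside y hy hyne with h | h
          · exact .inr (.inl ⟨hy, h⟩)
          · exact .inr (.inr ⟨hy, h⟩)

theorem card_noncrossingMatchings (A : Finset ℕ) :
    (noncrossingMatchings A).card = aeratedCatalan A.card := by
  induction hk : A.card using Nat.strong_induction_on generalizing A with
  | _ k ih =>
    rcases A.eq_empty_or_nonempty with rfl | hA
    · simp only [Finset.card_empty] at hk
      subst hk
      have h : noncrossingMatchings ∅ = {∅} := by
        ext P
        rw [mem_noncrossingMatchings, matchings_empty, Finset.mem_singleton, and_iff_left_iff_imp]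
        rintro rfl
        simp [IsNoncrossing]
      rw [h, Finset.card_singleton, aeratedCatalan_zero]
    · obtain ⟨a, B, haB, rfl⟩ : ∃ a B, (∀ b ∈ B, a < b) ∧ A = insert a B := by
        refine ⟨A.min' hA, A.erase (A.min' hA), fun b hb => ?_,
          (Finset.insert_erase (A.min'_mem hA)).symm⟩
        exact A.min'_lt_of_mem_erase_min' hA hb
      have haB' : a ∉ B := fun h => lt_irrefl _ (haB a h)
      rw [Finset.card_insert_of_notMem haB'] at hk
      subst hk
      rw [card_noncrossingMatchings_insert haB]
      have hsum : ∀ b ∈ B, (noncrossingMatchings (B.filter (· < b))).card *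
          (noncrossingMatchings (B.filter (b < ·))).card =
          aeratedCatalan (B.filter (· < b)).card * aeratedCatalan (B.filter (b < ·)).card := by
        intro b hb
        have h1 := Finset.card_filter_le B (· < b)
        have h2 := Finset.card_filter_le B (b < ·)
        rw [ih _ (by omega) _ rfl, ih _ (by omega) _ rfl]
      rw [Finset.sum_congr rfl hsum,
        sum_card_filter_lt B fun i j => aeratedCatalan i * aeratedCatalan j]
      rcases hB : B.card with - | m
      · simp [aeratedCatalan_one]
      · exact sum_range_aeratedCatalan_mul m

/-! ### The signed count of rooted acyclic orientations -/

open scoped Classical in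
/-- The signed number of pairs of a matching of `A` and an acyclic orientation of its crossing graph
whose unique source is the arch containing `a`. -/
noncomputable def signedRootedCount (A : Finset ℕ) (a : ℕ) : ℝ :=
  ∑ P ∈ matchings A, (-1) ^ (P.card + 1) * (rootedOrientations Crosses (a ∈ ·) P).card

/-- The graph identity `sum_card_rootedOrientations`, summed over all matchings of `A`. -/
theorem sum_signedRootedCount_mul {A : Finset ℕ} {a : ℕ} (ha : a ∈ A) :
    ∑ B ∈ A.powerset with a ∈ B,
      signedRootedCount B a * (noncrossingMatchings (A \ B)).card =
        (noncrossingMatchings A).card := by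
  classical
  have h := sum_matchings_split A a fun P Q =>
    (-1 : ℝ) ^ (P.card + 1) * (rootedOrientations Crosses (a ∈ ·) P).card *
      if IsNoncrossing Q then 1 else 0
  simp_rw [← Finset.sum_mul_sum, Finset.sum_boole] at h
  have hl : ∀ C, ((matchings C).filter IsNoncrossing).card = (noncrossingMatchings C).card :=
    fun C => by rw [noncrossingMatchings]
  simp_rw [hl] at h
  refine Eq.trans h ?_
  rw [← hl, ← Finset.sum_boole]
  refine Finset.sum_congr rfl fun R hR => ?_
  rw [mem_matchings] at hR
  obtain ⟨v, hvR, hav⟩ := (hR.2.2 a).mp ha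
  have huniq : ∀ u ∈ R, a ∈ u ↔ u = v := fun u hu =>
    ⟨fun hau => hR.2.1 u hu v hvR a hau hav, fun h => h ▸ hav⟩
  refine Eq.trans ?_ ((sum_card_rootedOrientations (adj := Crosses) (fun _ _ => Crosses.symm)
    not_crosses_self hvR).trans (if_congr Iff.rfl rfl rfl))
  simp only [mul_ite, mul_one, mul_zero]
  rw [← Finset.sum_filter, Finset.filter_filter]
  refine Finset.sum_congr ?_ fun S hS => ?_
  · ext S
    simp only [Finset.mem_filter, Finset.mem_powerset, Finset.mem_biUnion, id]
    refine and_congr_right fun hSR => and_congr_left fun _ => ?_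
    grind
  · rw [Finset.mem_filter, Finset.mem_powerset] at hS
    rw [rootedOrientations_congr fun u hu => huniq u (hS.1 hu)]

/-! ### Comparison of the two recursions -/

/-- Summation over the subsets of `A` containing `a`, by cardinality. -/
lemma sum_powerset_filter_mem_card {A : Finset ℕ} {a : ℕ} (ha : a ∈ A) (f : ℕ → ℝ) :
    ∑ B ∈ A.powerset with a ∈ B, f B.card =
      ∑ i ∈ Finset.range A.card, ((A.card - 1).choose i : ℝ) * f (i + 1) := by
  have h := Finset.sum_powerset_apply_card (fun i => f (i + 1)) (x := A.erase a)
  rw [Finset.card_erase_of_mem ha, Nat.sub_add_cancel (Finset.card_pos.mpr ⟨a, ha⟩)] at h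
  simp only [nsmul_eq_mul] at h
  rw [← h]
  refine Finset.sum_bij' (fun B _ => B.erase a) (fun D _ => insert a D) ?_ ?_ ?_ ?_ ?_
  · intro B hB
    simp only [Finset.mem_filter, Finset.mem_powerset] at hB ⊢
    exact Finset.erase_subset_erase a hB.1
  · intro D hD
    simp only [Finset.mem_filter, Finset.mem_powerset] at hD ⊢
    exact ⟨Finset.insert_subset ha (hD.trans (Finset.erase_subset a A)),
      Finset.mem_insert_self a D⟩
  · intro B hB
    exact Finset.insert_erase (Finset.mem_filter.mp hB).2
  · intro D hD
    exact Finset.erase_insert fun h =>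
      absurd (Finset.mem_powerset.mp hD h) (Finset.notMem_erase a A)
  · intro B hB
    rw [Finset.card_erase_add_one (Finset.mem_filter.mp hB).2]

/-- Both sides satisfy the moment-cumulant recursion. -/
theorem signedRootedCount_eq_qCumulant {A : Finset ℕ} {a : ℕ} (ha : a ∈ A) :
    signedRootedCount A a = qCumulant 0 A.card := by
  induction hk : A.card using Nat.strong_induction_on generalizing A with
  | _ k ih =>
    subst hk
    have hpos : 0 < A.card := Finset.card_pos.mpr ⟨a, ha⟩
    have h1 := sum_signedRootedCount_mul ha
    simp only [card_noncrossingMatchings, ← qMoment_zero] at h1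
    have h2 : ∑ B ∈ A.powerset with a ∈ B, qCumulant 0 B.card * qMoment 0 (A \ B).card =
        qMoment 0 A.card := by
      have hB : ∀ B ∈ A.powerset.filter (a ∈ ·),
          qCumulant 0 B.card * qMoment 0 (A \ B).card =
            qCumulant 0 B.card * qMoment 0 (A.card - B.card) := by
        intro B hB
        rw [Finset.mem_filter, Finset.mem_powerset] at hB
        rw [Finset.card_sdiff_of_subset hB.1]
      rw [Finset.sum_congr rfl hB,
        sum_powerset_filter_mem_card ha fun i => qCumulant 0 i * qMoment 0 (A.card - i)]
      obtain ⟨m, hm⟩ : ∃ m, A.card = m + 1 := ⟨A.card - 1, by omega⟩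
      rw [hm, qMoment_zero_succ]
      refine Finset.sum_congr rfl fun i _ => ?_
      rw [Nat.add_sub_cancel, Nat.add_sub_add_right, mul_assoc]
    rw [← h2, ← sub_eq_zero, ← Finset.sum_sub_distrib, Finset.sum_eq_single A] at h1
    · simp only [Finset.sdiff_self, Finset.card_empty, qMoment_zero, aeratedCatalan_zero,
        Nat.cast_one, mul_one] at h1
      exact sub_eq_zero.mp h1
    · intro B hB hne
      rw [Finset.mem_filter, Finset.mem_powerset] at hB
      rw [ih B.card (Finset.card_lt_card (hB.1.ssubset_of_ne hne)) hB.2 rfl, sub_self]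
    · intro h
      exact absurd (by simp [ha]) h

/-! ### Connected matchings with a rooted acyclic orientation -/

lemma two_mul_card_of_mem_matchings {A : Finset ℕ} {P : Finset (Finset ℕ)}
    (hP : P ∈ matchings A) : 2 * P.card = A.card := by
  obtain ⟨-, h1, h2, h3⟩ := Finset.mem_filter.mp hP
  rw [← h3, (Finset.card_biUnion h2 : (P.biUnion id).card = _),
    Finset.sum_congr rfl fun b hb => (h1 b hb : (id b).card = 2), Finset.sum_const,
    smul_eq_mul, mul_comm]

lemma parts_mem_matchings {A : Finset ℕ} (σ : Finpartition A) (h : ∀ b ∈ σ.parts, b.card = 2) :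
    σ.parts ∈ matchings A := by
  rw [mem_matchings]
  refine ⟨h, fun b hb c hc z hzb hzc => σ.eq_of_mem_parts hb hc hzb hzc, fun z => ?_⟩
  rw [← Finset.ext_iff.mp σ.biUnion_parts z, Finset.mem_biUnion]
  rfl

lemma exists_parts_eq {A : Finset ℕ} {P : Finset (Finset ℕ)} (hP : P ∈ matchings A) :
    ∃ σ : Finpartition A, σ.parts = P := by
  obtain ⟨-, h1, h2, h3⟩ := Finset.mem_filter.mp hP
  refine ⟨⟨P, Finset.supIndep_iff_pairwiseDisjoint.mpr h2, ?_, fun h => ?_⟩, rfl⟩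
  · rw [Finset.sup_eq_biUnion]
    exact h3
  · simpa using h1 _ h

/-- If an interval is the union of a set `S` of blocks, then no block of `S` crosses a block
outside `S`, so both `S` and its complement contain a source if they are not empty. -/
lemma eq_of_biUnion_eq_Icc {A : Finset ℕ} {P S : Finset (Finset ℕ)} (hP : P ∈ matchings A)
    {c : ℕ} {r : Finset (Finset ℕ × Finset ℕ)}
    (hr : r ∈ rootedOrientations Crosses (c ∈ ·) P) (hSP : S ⊆ P) {a b : ℕ} (hab : a ≤ b)
    (hS : S.biUnion id = Finset.Icc a b) : S = P := by
  rw [mem_matchings] at hP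
  obtain ⟨hsub, hadj, hac, hsrc⟩ := mem_rootedOrientations.mp hr
  have hmem : ∀ z, (∃ u ∈ S, z ∈ u) ↔ a ≤ z ∧ z ≤ b := by
    intro z
    rw [← Finset.mem_Icc, ← hS, Finset.mem_biUnion]
    rfl
  have hsep' : ∀ u ∈ S, ∀ w ∈ P, w ∉ S → ¬ Crosses u w := by
    intro u hu w hw hwS hcr
    have hdisj : ∀ z ∈ w, ¬ (a ≤ z ∧ z ≤ b) := by
      intro z hz hzab
      obtain ⟨u', hu', hzu'⟩ := (hmem z).mpr hzab
      exact hwS (hP.2.1 u' (hSP hu') w hw z hzu' hz ▸ hu')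
    rcases hcr with h | h <;> obtain ⟨i, j, k, l, hx, hy, h1, h2, h3⟩ := crossesLeft_iff.mp h
    · have hi := (hmem i).mp ⟨u, hu, (hx i).mpr (.inl rfl)⟩
      have hj := (hmem j).mp ⟨u, hu, (hx j).mpr (.inr rfl)⟩
      exact hdisj k ((hy k).mpr (.inl rfl)) (by omega)
    · have hk := (hmem k).mp ⟨u, hu, (hy k).mpr (.inl rfl)⟩
      have hl := (hmem l).mp ⟨u, hu, (hy l).mpr (.inr rfl)⟩
      exact hdisj j ((hx j).mpr (.inr rfl)) (by omega)
  have hsep : ∀ u w, (u, w) ∈ r → (u ∈ S ↔ w ∈ S) := by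
    intro u w h
    obtain ⟨hu, hw⟩ := Finset.mem_product.mp (hsub h)
    have hcr : Crosses u w := (hadj u hu w hw).mpr (.inl h)
    by_contra hne
    by_cases huS : u ∈ S
    · exact hsep' u huS w hw (by tauto) hcr
    · exact hsep' w (by tauto) u hu huS hcr.symm
  obtain ⟨u, hu, -⟩ := (hmem a).mpr ⟨le_rfl, hab⟩
  by_contra hne
  obtain ⟨x, hx, hxmin⟩ := exists_mem_forall_not_rel hac ⟨u, hu⟩
  obtain ⟨y, hy, hymin⟩ := exists_mem_forall_not_rel hac
    (Finset.sdiff_nonempty.mpr fun h => hne (hSP.antisymm h))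
  rw [Finset.mem_sdiff] at hy
  have hcx : c ∈ x := (hsrc x (hSP hx)).mp fun w hw => hxmin w ((hsep w x hw).mpr hx) hw
  have hcy : c ∈ y := (hsrc y hy.1).mp fun w hw => hymin w
    (Finset.mem_sdiff.mpr ⟨(Finset.mem_product.mp (hsub hw)).1,
      fun h => hy.2 ((hsep w y hw).mp h)⟩) hw
  exact hy.2 (hP.2.1 x (hSP hx) y hy.1 c hcx hcy ▸ hx)

variable {m : ℕ} {σ : Finpartition (Finset.Icc 1 m)}

open scoped Classical in
/-- The set of arrows of an acyclic orientation of the crossing graph. -/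
noncomputable def arrowSet (r : AcyclicOrientation (crossingGraph σ)) :
    Finset (Finset ℕ × Finset ℕ) :=
  (Finset.univ.filter fun e : σ.parts × σ.parts => r.arrow e.1 e.2).image
    fun e => ((e.1 : Finset ℕ), (e.2 : Finset ℕ))

lemma mem_arrowSet {r : AcyclicOrientation (crossingGraph σ)} {u w : Finset ℕ} :
    (u, w) ∈ arrowSet r ↔ ∃ (hu : u ∈ σ.parts) (hw : w ∈ σ.parts), r.arrow ⟨u, hu⟩ ⟨w, hw⟩ := by
  simp only [arrowSet, Finset.mem_image, Finset.mem_filter, Finset.mem_univ, true_and]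
  constructor
  · rintro ⟨e, h, h'⟩
    obtain ⟨rfl, rfl⟩ := Prod.mk.inj h'
    exact ⟨e.1.2, e.2.2, h⟩
  · rintro ⟨hu, hw, h⟩
    exact ⟨(⟨u, hu⟩, ⟨w, hw⟩), h, rfl⟩

lemma arrowSet_mem_rootedOrientations {r : AcyclicOrientation (crossingGraph σ)} {c : ℕ}
    (hr : ∀ v : σ.parts, r.IsSource v ↔ c ∈ (v : Finset ℕ)) :
    arrowSet r ∈ rootedOrientations Crosses (c ∈ ·) σ.parts := by
  rw [mem_rootedOrientations]
  refine ⟨fun e he => ?_, fun u hu w hw => ?_, fun u h => ?_, fun u hu => ?_⟩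
  · obtain ⟨hu, hw, -⟩ := mem_arrowSet.mp he
    exact Finset.mem_product.mpr ⟨hu, hw⟩
  · rw [mem_arrowSet, mem_arrowSet]
    refine (r.adj_iff ⟨u, hu⟩ ⟨w, hw⟩).trans (or_congr ?_ ?_)
    · exact ⟨fun h => ⟨hu, hw, h⟩, fun h => h.2.2⟩
    · exact ⟨fun h => ⟨hw, hu, h⟩, fun h => h.2.2⟩
  · have key : ∀ a b, Relation.TransGen (fun x y => (x, y) ∈ arrowSet r) a b →
        ∃ (ha : a ∈ σ.parts) (hb : b ∈ σ.parts),
          Relation.TransGen r.arrow ⟨a, ha⟩ ⟨b, hb⟩ := by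
      intro a b h
      induction h with
      | single h =>
        obtain ⟨ha, hb, h⟩ := mem_arrowSet.mp h
        exact ⟨ha, hb, .single h⟩
      | tail _ h ih =>
        obtain ⟨ha, hb, h'⟩ := ih
        obtain ⟨_, hc, h''⟩ := mem_arrowSet.mp h
        exact ⟨ha, hc, .tail h' h''⟩
    obtain ⟨hu, _, h⟩ := key u u h
    exact r.acyclic _ h
  · rw [← hr ⟨u, hu⟩]
    constructor
    · exact fun h w hw => h w (mem_arrowSet.mpr ⟨w.2, hu, hw⟩)
    · intro h w hw
      obtain ⟨hw, _, h'⟩ := mem_arrowSet.mp hw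
      exact h ⟨w, hw⟩ h'

lemma exists_arrowSet_eq {c : ℕ} {R : Finset (Finset ℕ × Finset ℕ)}
    (hR : R ∈ rootedOrientations Crosses (c ∈ ·) σ.parts) :
    ∃ r : AcyclicOrientation (crossingGraph σ),
      (∀ v : σ.parts, r.IsSource v ↔ c ∈ (v : Finset ℕ)) ∧ arrowSet r = R := by
  obtain ⟨hsub, hadj, hac, hsrc⟩ := mem_rootedOrientations.mp hR
  refine ⟨⟨fun u w => (u.1, w.1) ∈ R, fun u w => hadj u u.2 w w.2,
    fun u w h h' => hac u (.tail (.single h) h'), fun v h => hac v ?_⟩, fun v => ?_, ?_⟩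
  · exact Relation.TransGen.lift (fun x : σ.parts => (x : Finset ℕ)) (fun _ _ h => h) _ _ h
  · rw [← hsrc v v.2]
    exact ⟨fun h w hw => h ⟨w, (Finset.mem_product.mp (hsub hw)).1⟩ hw, fun h w hw => h w hw⟩
  · ext ⟨u, w⟩
    rw [mem_arrowSet]
    exact ⟨fun h => h.2.2, fun h =>
      ⟨(Finset.mem_product.mp (hsub h)).1, (Finset.mem_product.mp (hsub h)).2, h⟩⟩

lemma arrowSet_injective : Function.Injective (arrowSet (σ := σ)) := by
  intro r r' h
  have harr : r.arrow = r'.arrow := by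
    ext u w
    have h1 := Finset.ext_iff.mp h (u.1, w.1)
    rw [mem_arrowSet, mem_arrowSet] at h1
    exact ⟨fun h => (h1.mp ⟨u.2, w.2, h⟩).2.2, fun h => (h1.mpr ⟨u.2, w.2, h⟩).2.2⟩
  obtain ⟨arrow, _, _, _⟩ := r
  obtain ⟨arrow', _, _, _⟩ := r'
  subst harr
  rfl

/-- Connectedness of the matching may be dropped, since it follows from the uniqueness of the
source. -/
theorem card_connectedMatching_sigma (n : ℕ) :
    Nat.card {p : (σ : ConnectedMatching n) × AcyclicOrientation (crossingGraph σ.1) //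
        ∀ v : p.1.1.parts, p.2.IsSource v ↔ 1 ∈ (v : Finset ℕ)} =
      ∑ P ∈ matchings (Finset.Icc 1 (2 * n)),
        (rootedOrientations Crosses (1 ∈ ·) P).card := by
  rw [← Finset.card_sigma, ← Fintype.card_coe, ← Nat.card_eq_fintype_card]
  refine Nat.card_eq_of_bijective (fun p => ⟨⟨p.1.1.1.parts, arrowSet p.1.2⟩,
    Finset.mem_sigma.mpr ⟨parts_mem_matchings _ p.1.1.2.1,
      arrowSet_mem_rootedOrientations p.2⟩⟩) ⟨?_, ?_⟩
  · rintro ⟨⟨⟨σ, hσ⟩, r⟩, hr⟩ ⟨⟨⟨σ', hσ'⟩, r'⟩, hr'⟩ h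
    simp only [Subtype.mk.injEq, Sigma.mk.injEq, heq_eq_eq] at h
    obtain ⟨h1, h2⟩ := h
    obtain rfl : σ = σ' := Finpartition.ext h1
    obtain rfl : r = r' := arrowSet_injective h2
    rfl
  · rintro ⟨⟨P, R⟩, h⟩
    obtain ⟨hP, hR⟩ := Finset.mem_sigma.mp h
    obtain ⟨σ, rfl⟩ := exists_parts_eq hP
    obtain ⟨r, hr, rfl⟩ := exists_arrowSet_eq hR
    refine ⟨⟨⟨⟨σ, (mem_matchings.mp hP).1, ?_⟩, r⟩, hr⟩, rfl⟩
    rintro a b - hab - ⟨S, hS, hSab⟩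
    rw [← hSab, eq_of_biUnion_eq_Icc hP hR hS hab hSab]
    exact σ.biUnion_parts

end SemicircularCumulants

theorem mainTheorem3 (n : ℕ) (hn : 1 ≤ n) :
    normalizedCumulant 0 n =
      (Nat.card {p : (σ : ConnectedMatching n) × AcyclicOrientation (crossingGraph σ.1) //
        ∀ v : p.1.1.parts, p.2.IsSource v ↔ 1 ∈ (v : Finset ℕ)} : ℝ) := by
  have h := SemicircularCumulants.signedRootedCount_eq_qCumulant
    (A := Finset.Icc 1 (2 * n)) (a := 1) (by simp; omega)
  rw [Nat.card_Icc, Nat.add_sub_cancel] at h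
  have hcard : ∀ P ∈ SemicircularCumulants.matchings (Finset.Icc 1 (2 * n)), P.card = n := by
    intro P hP
    have := SemicircularCumulants.two_mul_card_of_mem_matchings hP
    rw [Nat.card_Icc] at this
    omega
  rw [normalizedCumulant, ← h, SemicircularCumulants.card_connectedMatching_sigma,
    SemicircularCumulants.signedRootedCount, Finset.sum_div, Nat.cast_sum]
  refine Finset.sum_congr rfl fun P hP => ?_
  obtain ⟨k, rfl⟩ : ∃ k, n = k + 1 := ⟨n - 1, by omega⟩
  rw [hcard P hP, Nat.add_sub_cancel, zero_sub, add_assoc, pow_add]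
  have : (-1 : ℝ) ^ k ≠ 0 := pow_ne_zero _ (by norm_num)
  field_simp
  norm_num
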